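/- Let $\Phi_M$ (Mcells) and $\Phi_S$ (Scells) be independent homogeneous Poisson point processes in $\mathbb{R}^2$ with intensities $\lambda_M,\lambda_S>0$. For $k\in\{M,S\}$ let $P_k,Q_k>0$ be the downlink and uplink transmit powers, $G_k>0$ the antenna gain, $\alpha_k>0$ the path-loss exponent, put $\bar P_k=P_kG_k$, $\bar Q_k=Q_kG_k$, and assume $\bar Q_S/\bar Q_M>\bar P_S/\bar P_M$. The typical user is at the origin. In the uplink it associates with a base station $x^*\in\Phi_l$, $l\in\{M,S\}$, if and only if $\bar Q_l\|x^*\|^{-\alpha_l}\ge \bar Q_k\|x\|^{-\alpha_k}$ for all $k\in\{M,S\}$ and $x\in\Phi_k$; in the downlink the same rule holds with $\bar P$ in place of $\bar Q$. Case 1 is the event that some $x^*\in\Phi_M$ is both the uplink and the downlink base station of the typical user. Up to a null set, this is the event that $$X_M^{-\alpha_M}>\frac{\bar P_S}{\bar P_M}X_S^{-\alpha_S}\quad\text{and}\quad X_M^{-\alpha_M}>\frac{\bar Q_S}{\bar Q_M}X_S^{-\alpha_S},$$ where $X_k$ is the distance from the origin to the nearest point of $\Phi_k$. Its probability is $$\Pr(\text{Case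 1})=1-\frac{\alpha_M}{2\alpha_S}\,H^{1,1}_{1,1}\!\left[z_1\,\middle|\,\begin{matrix}(0,\tfrac12)\\(0,\tfrac{\alpha_M}{2\alpha_S})\end{matrix}\right],\qquad z_1=\left(\sqrt{\pi\lambda_M}\right)^{\alpha_M/\alpha_S}\left(\frac{\bar Q_M}{\bar Q_S}\right)^{1/\alpha_S}\left(\sqrt{\pi\lambda_S}\right)^{-1}.$$ Here $H^{1,1}_{1,1}$ is Fox's H-function: for $z>0$, $$H^{1,1}_{1,1}\!\left[z\,\middle|\,\begin{matrix}(a,A)\\(b,B)\end{matrix}\right]=\frac1{2\pi i}\int_{\gamma-i\infty}^{\gamma+i\infty}\Gamma(b+Bs)\,\Gamma(1-a-As)\,z^{-s}\,ds,$$ where the line $\operatorname{Re}s=\gamma$ has the poles of $\Gamma(b+Bs)$ on its left and those of $\Gamma(1-a-As)$ on its right. For the parameters above and $z=z_1$, such lines exist, and the integral converges absolutely and has the same value along each of them. -/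

import Mathlib

open MeasureTheory ProbabilityTheory

noncomputable section

/-! ### Fox's H-function -/

/-- The parameters `(a i, A i)`, `i < p`, and `(b j, B j)`, `j < q`, of a Fox H-function. -/
structure FoxParams (p q : ℕ) where
  a : Fin p → ℂ
  A : Fin p → ℝ
  b : Fin q → ℂ
  B : Fin q → ℝ

namespace FoxParams

/-- The Mellin–Barnes kernel of `H^{m,n}_{p,q}`:
`∏_{j ≤ m} Γ(b_j + B_j s) ∏_{i ≤ n} Γ(1 - a_i - A_i s)` divided by
`∏_{i > n} Γ(a_i + A_i s) ∏_{j > m} Γ(1 - b_j - B_j s)`.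
(Mathlib's `Γ` is `0` at its poles and `x / 0 = 0`, so that the reciprocal Gamma factors are correct everywhere.) -/
def kernel {p q : ℕ} (D : FoxParams p q) (m n : ℕ) (s : ℂ) : ℂ :=
  ((∏ j ∈ Finset.univ.filter (fun j : Fin q => (j : ℕ) < m),
        Complex.Gamma (D.b j + (D.B j : ℂ) * s)) *
      ∏ i ∈ Finset.univ.filter (fun i : Fin p => (i : ℕ) < n),
        Complex.Gamma (1 - D.a i - (D.A i : ℂ) * s)) /
    ((∏ i ∈ Finset.univ.filter (fun i : Fin p => n ≤ (i : ℕ)),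
        Complex.Gamma (D.a i + (D.A i : ℂ) * s)) *
      ∏ j ∈ Finset.univ.filter (fun j : Fin q => m ≤ (j : ℕ)),
        Complex.Gamma (1 - D.b j - (D.B j : ℂ) * s))

/-- The vertical line `Re s = γ` has all poles `-(b_j + k) / B_j`, `j ≤ m`, of the first group of
Gamma factors on its left and all poles `(1 - a_i + k) / A_i`, `i ≤ n`, of the second group
on its right. -/
def Separates {p q : ℕ} (D : FoxParams p q) (m n : ℕ) (γ : ℝ) : Prop :=
  (∀ j : Fin q, (j : ℕ) < m → ∀ k : ℕ, -((D.b j).re + k) / D.B j < γ) ∧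
    ∀ i : Fin p, (i : ℕ) < n → ∀ k : ℕ, γ < (1 - (D.a i).re + k) / D.A i

end FoxParams

open Classical in
/-- Fox's H-function `H^{m,n}_{p,q}[z | (a_i, A_i); (b_j, B_j)]` at `z > 0`, that is
`(1 / 2πi) ∫ kernel(s) z^{-s} ds` along a vertical line `Re s = γ` which separates the two groups
of poles (`mellinInv γ f z` is `(1 / 2πi) ∫ f(s) z^{-s} ds` along `Re s = γ`).
See `FoxHConverges` for the convergence and the independence of `γ`. -/
def foxH {p q : ℕ} (m n : ℕ) (D : FoxParams p q) (z : ℝ) : ℂ :=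
  if h : ∃ γ : ℝ, D.Separates m n γ then mellinInv h.choose (D.kernel m n) z else 0

/-- The H-function is properly defined at `z > 0`: a separating vertical line exists, and along each
such line the Mellin–Barnes integral converges absolutely (on such a line `|z^{-s}|` is constant)
and has the same value. -/
def FoxHConverges {p q : ℕ} (m n : ℕ) (D : FoxParams p q) (z : ℝ) : Prop :=
  (∃ γ : ℝ, D.Separates m n γ) ∧
    ∀ γ : ℝ, D.Separates m n γ →
      Complex.VerticalIntegrable (D.kernel m n) γ ∧ mellinInv γ (D.kernel m n) z = foxH m n D z

/-! ### Poisson point processes in the plane -/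

/-- The Euclidean plane. -/
abbrev Plane : Type := EuclideanSpace ℝ (Fin 2)

/-- The number of points of the random set `Φ` in `B`. -/
def pointCount {Ω : Type*} (Φ : Ω → Set Plane) (B : Set Plane) (ω : Ω) : ℕ :=
  (Φ ω ∩ B).ncard

/-- `Φ` is a (simple, locally finite) homogeneous Poisson point process of intensity `lam`
in the plane. -/
structure IsHomogeneousPPP {Ω : Type*} [MeasurableSpace Ω] (μ : Measure Ω) (lam : ℝ)
    (Φ : Ω → Set Plane) : Prop where
  locallyFinite : ∀ ω, ∀ B : Set Plane, Bornology.IsBounded B → (Φ ω ∩ B).Finite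
  measurable_count : ∀ B : Set Plane, MeasurableSet B → Bornology.IsBounded B →
    Measurable (pointCount Φ B)
  poisson_count : ∀ B : Set Plane, MeasurableSet B → Bornology.IsBounded B →
    μ.map (pointCount Φ B) = poissonMeasure (lam * volume.real B).toNNReal
  indep_count : ∀ (N : ℕ) (B : Fin N → Set Plane),
    (∀ i, MeasurableSet (B i)) → (∀ i, Bornology.IsBounded (B i)) →
    Pairwise (fun i j => Disjoint (B i) (B j)) → iIndepFun (fun i => pointCount Φ (B i)) μ

/-- The σ-algebra generated by a point process, i.e. by its counts in bounded Borel sets. -/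
abbrev pointProcessSigma {Ω : Type*} (Φ : Ω → Set Plane) : MeasurableSpace Ω :=
  ⨆ (B : Set Plane) (_ : MeasurableSet B) (_ : Bornology.IsBounded B),
    MeasurableSpace.comap (pointCount Φ B) inferInstance

/-! ### The two-tier network, seen from the typical UE at the origin -/

/-- The two tiers: `M` (Mcell, sub-6GHz) and `S` (Scell, mmW). -/
inductive Tier : Type
  | M
  | S

/-- Biased power `W_k G_k ‖x‖^(-α_k)` of the link between the UE at the origin and a BS of
tier `k` at `x`, for transmit powers `W`, antenna gains `G` and path-loss exponents `α`. -/
def linkPower (W G α : Tier → ℝ) (k : Tier) (x : Plane) : ℝ :=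
  W k * G k * ‖x‖ ^ (-α k)

/-- For BS locations `φ`, the UE at the origin associates with the BS of tier `l` at `x`:
no BS of either tier has a larger link power. -/
def UEAssociates (W G α : Tier → ℝ) (φ : Tier → Set Plane) (l : Tier) (x : Plane) : Prop :=
  x ∈ φ l ∧ ∀ k : Tier, ∀ y ∈ φ k, linkPower W G α k y ≤ linkPower W G α l x

/-- Case 1: the uplink BS (powers `Q`) and the downlink BS (powers `P`) are the same Mcell BS. -/
def case1 {Ω : Type*} (P Q G α : Tier → ℝ) (Φ : Tier → Ω → Set Plane) : Set Ω :=
  {ω | ∃ x : Plane, UEAssociates Q G α (fun k => Φ k ω) Tier.M x ∧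
    UEAssociates P G α (fun k => Φ k ω) Tier.M x}

/-- Distance `X_k` from the UE at the origin to the nearest point of `Φ` (which is almost surely
non-empty). -/
def nearestDist {Ω : Type*} (Φ : Ω → Set Plane) (ω : Ω) : ℝ :=
  Metric.infDist (0 : Plane) (Φ ω)

/-- Case 1 written in terms of the distances to the nearest BSs of the two tiers:
`X_M^{-α_M} > (P_S G_S / P_M G_M) X_S^{-α_S}` and the same with `Q` in place of `P`. -/
def case1Dist {Ω : Type*} (P Q G α : Tier → ℝ) (Φ : Tier → Ω → Set Plane) : Set Ω :=
  {ω | (P .S * G .S) / (P .M * G .M) * nearestDist (Φ .S) ω ^ (-α .S)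
        < nearestDist (Φ .M) ω ^ (-α .M) ∧
      (Q .S * G .S) / (Q .M * G .M) * nearestDist (Φ .S) ω ^ (-α .S)
        < nearestDist (Φ .M) ω ^ (-α .M)}

/-- The argument
`z₁ = √(π λ_M) ^ (α_M / α_S) * (Q_M G_M / Q_S G_S) ^ (1 / α_S) * (√(π λ_S))⁻¹`. -/
def z1 (lam Q G α : Tier → ℝ) : ℝ :=
  √(Real.pi * lam .M) ^ (α .M / α .S) * ((Q .M * G .M) / (Q .S * G .S)) ^ (1 / α .S) *
    (√(Real.pi * lam .S))⁻¹

/-- The parameters `(0, 1/2); (0, α_M / (2 α_S))`. -/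
def case1Params (α : Tier → ℝ) : FoxParams 1 1 where
  a := fun _ => 0
  A := fun _ => 1 / 2
  b := fun _ => 0
  B := fun _ => α .M / (2 * α .S)

end

/-!
The probability of Case 1 and the H-function are both reduced to the real integral
`I = ∫_0^∞ e^{-t} exp (-(z₁ √t) ^ (2 α_S / α_M)) dt`, and the claim is that Case 1 has
probability `1 - I` while `α_M / (2 α_S)` times the H-function is `I`.

On the analytic side put `B = α_M / (2 α_S)`. The kernel is `Γ(B s) Γ(1 - s / 2)`, and the
separating lines are those with `0 < Re s < 2`. Writing `Γ(1 - s / 2)` as Euler's integral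
`∫ e^{-t} t^{-s/2} dt` and exchanging the integrals leaves the inverse Mellin transform of `Γ(B s)`
at `z √t`, which by Mellin inversion is `B⁻¹ exp (-(z √t) ^ (1 / B))`, whatever the line
(`mellinInv_Gamma_mul_Gamma`). The exchange, the inversion and the absolute convergence all rest on
the integrability of `Γ` along vertical lines (`verticalIntegrable_Gamma`).

On the probabilistic side the void probabilities show that `T_k = π λ_k X_k²` are independent
standard exponential variables (`IsHomogeneousPPP.map_nearestDist_sq`). In particular, almost
surely both processes are non-empty, avoid the origin, and produce no tie, so that association is
decided by the nearest points (`exists_UEAssociates_iff`). The uplink condition implies the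
downlink one, and in terms of `T_M` and `T_S` it reads `T_M ≤ (z₁ √T_S) ^ (2 α_S / α_M)`
(`le_threshold_iff`). The complement has probability `I`, as is seen by conditioning on `T_S`
(`expMeasure_prod_setOf_lt`).
-/

/-! ### Mellin–Barnes integrals of two Gamma functions -/

open Complex Set in
/-- The Gamma function is integrable along vertical lines in the right half-plane: from
`Γ(s) = Γ(s + 2) / (s (s + 1))` and `|Γ(s + 2)| ≤ Γ(Re s + 2)` it decays at least like `1 / |s|²`,
so that Stirling's formula is not needed. -/
theorem verticalIntegrable_Gamma {σ : ℝ} (hσ : 0 < σ) : VerticalIntegrable Gamma σ := by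
  have hre (y : ℝ) : ((σ : ℂ) + y * I).re = σ := by simp
  have hcont : Continuous fun y : ℝ => Gamma (σ + y * I) := by
    rw [continuous_iff_continuousAt]
    intro y
    have h : ContinuousAt Gamma ((σ : ℂ) + y * I) := by
      refine continuousAt_Gamma _ fun m hm => ?_
      have := congrArg re hm
      rw [hre] at this
      simp only [neg_re, natCast_re] at this
      linarith [Nat.cast_nonneg (α := ℝ) m]
    exact ContinuousAt.comp (f := fun y : ℝ => (σ : ℂ) + y * I) h (by fun_prop)
  set c := min 1 (σ ^ 2) with hc
  have hc0 : 0 < c := by positivity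
  refine ((integrable_inv_one_add_sq.const_mul (Real.Gamma (σ + 2) / c))).mono'
    hcont.aestronglyMeasurable (Filter.Eventually.of_forall fun y => ?_)
  set s : ℂ := σ + y * I with hs
  have hs0 : s ≠ 0 := fun h => by have := hre y; rw [← hs, h] at this; simp at this; linarith
  have hs1 : s + 1 ≠ 0 := fun h => by
    have := congrArg re h
    rw [add_re, hs, hre] at this; simp at this; linarith
  -- Two steps of the functional equation turn the bound on `Γ(s + 2)` into
  -- quadratic decay of `Γ(s)`.
  have hG : Gamma (s + 2) = (s + 1) * (s * Gamma s) := by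
    rw [← Gamma_add_one s hs0, ← Gamma_add_one _ hs1]; ring_nf
  have hbound : ‖Gamma (s + 2)‖ ≤ Real.Gamma (σ + 2) := by
    have h2 : (s + 2).re = σ + 2 := by simp [hs]
    rw [Gamma_eq_integral (by rw [h2]; positivity), GammaIntegral,
      Real.Gamma_eq_integral (by positivity)]
    refine (norm_integral_le_integral_norm _).trans (le_of_eq ?_)
    refine setIntegral_congr_fun measurableSet_Ioi fun x hx => ?_
    simp only [norm_mul]
    rw [norm_cpow_eq_rpow_re_of_pos hx, sub_re, h2, norm_real,
      Real.norm_of_nonneg (Real.exp_pos _).le, one_re]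
  have hns : ‖s‖ ^ 2 = σ ^ 2 + y ^ 2 := by
    rw [← normSq_eq_norm_sq, hs, normSq_add_mul_I]
  have hns1 : ‖s + 1‖ ^ 2 = (σ + 1) ^ 2 + y ^ 2 := by
    rw [← normSq_eq_norm_sq, show s + 1 = ((σ + 1 : ℝ) : ℂ) + y * I by rw [hs]; push_cast; ring,
      normSq_add_mul_I]
  have hle : ‖s‖ ≤ ‖s + 1‖ := by
    refine le_of_sq_le_sq ?_ (norm_nonneg _)
    rw [hns, hns1]; nlinarith
  have hprod : c * (1 + y ^ 2) ≤ ‖s + 1‖ * ‖s‖ := by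
    calc c * (1 + y ^ 2) ≤ σ ^ 2 + y ^ 2 := by
          nlinarith [min_le_left 1 (σ ^ 2), min_le_right 1 (σ ^ 2), sq_nonneg y]
      _ = ‖s‖ * ‖s‖ := by rw [← hns, sq]
      _ ≤ _ := by gcongr
  rw [hG, norm_mul, norm_mul, ← mul_assoc] at hbound
  have hy : 0 < 1 + y ^ 2 := by positivity
  rw [div_mul_eq_mul_div, ← div_eq_mul_inv, div_div, le_div_iff₀ (by positivity)]
  calc _ ≤ ‖Gamma s‖ * (‖s + 1‖ * ‖s‖) := by rw [mul_comm (1 + y ^ 2)]; gcongr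
    _ ≤ _ := by linarith

open Complex in
theorem mellin_exp_neg_rpow {B : ℝ} (hB : 0 < B) {s : ℂ} (hs : 0 < s.re) :
    HasMellin (fun x : ℝ => (((1 / B) * Real.exp (-x ^ (1 / B)) : ℝ) : ℂ)) s (Gamma (B * s)) := by
  have hf : (fun x : ℝ => (((1 / B) * Real.exp (-x ^ (1 / B)) : ℝ) : ℂ)) =
      fun x : ℝ => ((1 / B : ℝ) : ℂ) • (fun x : ℝ => ((Real.exp (-x) : ℝ) : ℂ)) (x ^ (1 / B)) := by
    ext x; simp
  have hsB : s / ((1 / B : ℝ) : ℂ) = B * s := by push_cast; field_simp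
  have hre : 0 < (B * s).re := by rw [re_ofReal_mul]; positivity
  rw [hf]
  constructor
  · refine MellinConvergent.const_smul ?_ _
    rw [MellinConvergent.comp_rpow (f := fun x : ℝ => ((Real.exp (-x) : ℝ) : ℂ)) (by positivity),
      hsB]
    have := GammaIntegral_convergent hre
    simpa [MellinConvergent, mul_comm] using this
  · rw [mellin_const_smul, mellin_comp_rpow (fun x : ℝ => ((Real.exp (-x) : ℝ) : ℂ)), hsB,
      ← GammaIntegral_eq_mellin, ← Gamma_eq_integral hre, abs_of_pos (by positivity)]
    simp only [smul_eq_mul, real_smul]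
    push_cast
    have : (B : ℂ) ≠ 0 := by exact_mod_cast hB.ne'
    field_simp

open Complex in
theorem verticalIntegrable_Gamma_mul {B γ : ℝ} (hB : 0 < B) (hγ : 0 < γ) :
    VerticalIntegrable (fun s => Gamma (B * s)) γ := by
  have h := (verticalIntegrable_Gamma (mul_pos hB hγ)).comp_mul_left' hB.ne'
  refine h.congr (Filter.Eventually.of_forall fun y => ?_)
  simp only
  congr 1; push_cast; ring

open Complex in
theorem mellinInv_Gamma_mul {B γ x : ℝ} (hB : 0 < B) (hγ : 0 < γ) (hx : 0 < x) :
    mellinInv γ (fun s => Gamma (B * s)) x = (((1 / B) * Real.exp (-x ^ (1 / B)) : ℝ) : ℂ) := by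
  set f := fun x : ℝ => (((1 / B) * Real.exp (-x ^ (1 / B)) : ℝ) : ℂ) with hf
  have hM (y : ℝ) : mellin f (γ + y * I) = Gamma (B * (γ + y * I)) :=
    (mellin_exp_neg_rpow hB (by simpa using hγ)).2
  have hc : ContinuousAt f x := by
    refine continuous_ofReal.continuousAt.comp ?_
    refine continuousAt_const.mul (Real.continuous_exp.continuousAt.comp ?_)
    exact (Real.continuousAt_rpow_const _ _ (.inl hx.ne')).neg
  have hV : VerticalIntegrable (mellin f) γ :=
    (verticalIntegrable_Gamma_mul hB hγ).congr (Filter.Eventually.of_forall fun y => (hM y).symm)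
  calc _ = mellinInv γ (mellin f) x := by simp only [mellinInv, hM]
    _ = f x := mellinInv_mellin_eq γ f hx (mellin_exp_neg_rpow hB (by simpa using hγ)).1 hV hc

/-- Absolute convergence of the double integral, over the height `y` of `s = γ + y i` and over the
Euler variable `t`, obtained by inserting Euler's integral for `Γ(1 - s / 2)` into the
Mellin–Barnes integral. The powers `z ^ (-s)` and `t ^ (-s / 2)` are combined into
`(z √t) ^ (-s)`. -/
theorem integrable_gamma_kernel {B γ z : ℝ} (hB : 0 < B) (hγ : 0 < γ) (hγ2 : γ < 2) (hz : 0 < z) :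
    Integrable (fun p : ℝ × ℝ => (Real.exp (-p.2) : ℂ) *
        (((z * √p.2 : ℝ) : ℂ) ^ (-(γ + p.1 * Complex.I)) *
          Complex.Gamma (B * (γ + p.1 * Complex.I))))
      (volume.prod (volume.restrict (Set.Ioi 0))) := by
  have h1 := verticalIntegrable_Gamma_mul hB hγ
  have h2 : Integrable (fun t : ℝ => Real.exp (-t) * t ^ ((1 - γ / 2) - 1))
    (volume.restrict (Set.Ioi 0)) := Real.GammaIntegral_convergent (by linarith)
  have hm : Measurable fun p : ℝ × ℝ => ((z * √p.2 : ℝ) : ℂ) ^ (-(γ + p.1 * Complex.I)) := by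
    fun_prop
  refine ((h1.norm.const_mul (z ^ (-γ))).mul_prod h2).mono' ?_ ?_
  · refine AEStronglyMeasurable.mul (by fun_prop) (hm.aestronglyMeasurable.mul ?_)
    exact h1.aestronglyMeasurable.comp_fst
  · have : ∀ᵐ p : ℝ × ℝ ∂(volume.prod (volume.restrict (Set.Ioi 0))), 0 < p.2 :=
      Measure.quasiMeasurePreserving_snd.ae (ae_restrict_mem measurableSet_Ioi)
    filter_upwards [this] with p hp
    rw [norm_mul, norm_mul, Complex.norm_of_nonneg (Real.exp_pos _).le,
      Complex.norm_cpow_eq_rpow_re_of_pos (by positivity), Real.mul_rpow hz.le (by positivity),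
      Real.sqrt_eq_rpow, ← Real.rpow_mul hp.le]
    simp only [Complex.neg_re, Complex.add_re, Complex.ofReal_re, Complex.mul_re, Complex.I_re,
      Complex.ofReal_im, Complex.I_im]
    apply le_of_eq
    ring_nf

open Complex Set in
theorem cpow_mul_Gamma_mul_Gamma_eq_integral {B γ z : ℝ} (hγ2 : γ < 2) (hz : 0 < z) (y : ℝ) :
    (z : ℂ) ^ (-(γ + y * I)) • (Gamma (B * (γ + y * I)) * Gamma (1 - (γ + y * I) / 2)) =
      ∫ t in Ioi 0, (Real.exp (-t) : ℂ) *
        (((z * √t : ℝ) : ℂ) ^ (-(γ + y * I)) * Gamma (B * (γ + y * I))) := by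
  have hre : 0 < (1 - ((γ : ℂ) + y * I) / 2).re := by simp; linarith
  rw [Gamma_eq_integral hre, GammaIntegral, smul_eq_mul, ← mul_assoc, ← integral_const_mul]
  refine setIntegral_congr_fun measurableSet_Ioi fun t ht => ?_
  have ht' : (0 : ℝ) ≤ t := le_of_lt ht
  rw [ofReal_mul, mul_cpow_ofReal_nonneg hz.le (Real.sqrt_nonneg _), Real.sqrt_eq_rpow,
    ← cpow_mul_ofReal_nonneg ht',
    show (1 - ((γ : ℂ) + y * I) / 2 - 1) = ((1 / 2 : ℝ) : ℂ) * -(γ + y * I) by push_cast; ring]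
  ring

open Complex in
/-- By Fubini's theorem: the product is the inner integral of `integrable_gamma_kernel` at
`z = 1`. -/
theorem verticalIntegrable_Gamma_mul_Gamma {B γ : ℝ} (hB : 0 < B) (hγ : 0 < γ) (hγ2 : γ < 2) :
    VerticalIntegrable (fun s => Gamma (B * s) * Gamma (1 - s / 2)) γ := by
  refine (integrable_gamma_kernel hB hγ hγ2 one_pos).integral_prod_left.congr
    (Filter.Eventually.of_forall fun y => ?_)
  simp only
  rw [← cpow_mul_Gamma_mul_Gamma_eq_integral hγ2 one_pos]
  simp

open Complex Set in
/-- The Mellin–Barnes integral as a real integral: after Fubini's theorem, the inner integral over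
the vertical line is the inverse Mellin transform of `Γ(B s)` at `z √t`. -/
theorem mellinInv_Gamma_mul_Gamma {B γ z : ℝ} (hB : 0 < B) (hγ : 0 < γ) (hγ2 : γ < 2)
    (hz : 0 < z) :
    mellinInv γ (fun s => Gamma (B * s) * Gamma (1 - s / 2)) z =
      (((1 / B) * ∫ t in Ioi 0, Real.exp (-t) * Real.exp (-(z * √t) ^ (1 / B)) : ℝ) : ℂ) := by
  rw [mellinInv]
  simp_rw [cpow_mul_Gamma_mul_Gamma_eq_integral hγ2 hz]
  rw [integral_integral_swap (integrable_gamma_kernel hB hγ hγ2 hz), ← integral_smul,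
    ← integral_const_mul, ← integral_complex_ofReal]
  refine setIntegral_congr_fun measurableSet_Ioi fun t ht => ?_
  have ht' : (0 : ℝ) < t := ht
  have := mellinInv_Gamma_mul hB hγ (x := z * √t) (by positivity)
  rw [mellinInv] at this
  simp only [smul_eq_mul] at this ⊢
  rw [integral_const_mul, ← Algebra.mul_smul_comm, this]
  push_cast
  ring

/-! ### The H-function of Case 1 -/

theorem case1Params_kernel (α : Tier → ℝ) : (case1Params α).kernel 1 1 =
    fun s => Complex.Gamma ((α .M / (2 * α .S) : ℝ) * s) * Complex.Gamma (1 - s / 2) := by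
  ext s
  simp only [FoxParams.kernel, case1Params, Finset.univ_unique, Finset.filter_singleton]
  simp [div_eq_inv_mul]

theorem case1Params_separates {α : Tier → ℝ} (hα : ∀ k, 0 < α k) {γ : ℝ} :
    (case1Params α).Separates 1 1 γ ↔ 0 < γ ∧ γ < 2 := by
  have hB : 0 < α .M / (2 * α .S) := div_pos (hα _) (mul_pos two_pos (hα _))
  constructor
  · rintro ⟨h1, h2⟩
    have h1 := h1 0 (by simp) 0
    have h2 := h2 0 (by simp) 0
    simp only [case1Params] at h1 h2
    norm_num at h1 h2
    exact ⟨h1, h2⟩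
  · rintro ⟨h1, h2⟩
    refine ⟨fun j _ k => ?_, fun i _ k => ?_⟩
    · refine lt_of_le_of_lt (div_nonpos_of_nonpos_of_nonneg ?_ hB.le) h1
      simp [case1Params]
    · refine h2.trans_le ?_
      simp [case1Params]


theorem mellinInv_case1Params {α : Tier → ℝ} (hα : ∀ k, 0 < α k) {γ z : ℝ}
    (hγ : (case1Params α).Separates 1 1 γ) (hz : 0 < z) :
    ((α .M / (2 * α .S) : ℝ) : ℂ) * mellinInv γ ((case1Params α).kernel 1 1) z =
      ((∫ t in Set.Ioi 0,
        Real.exp (-t) * Real.exp (-(z * √t) ^ (2 * α .S / α .M)) : ℝ) : ℂ) := by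
  have hB : 0 < α .M / (2 * α .S) := div_pos (hα _) (mul_pos two_pos (hα _))
  obtain ⟨h0, h2⟩ := (case1Params_separates hα).1 hγ
  rw [case1Params_kernel, mellinInv_Gamma_mul_Gamma hB h0 h2 hz, ← Complex.ofReal_mul, one_div_div,
    ← mul_assoc, div_mul_div_cancel₀ (mul_pos two_pos (hα _)).ne', div_self (hα _).ne', one_mul]

theorem case1Params_separates_one {α : Tier → ℝ} (hα : ∀ k, 0 < α k) :
    (case1Params α).Separates 1 1 1 :=
  (case1Params_separates hα).2 ⟨one_pos, one_lt_two⟩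

theorem mul_foxH_case1Params {α : Tier → ℝ} (hα : ∀ k, 0 < α k) {z : ℝ} (hz : 0 < z) :
    ((α .M / (2 * α .S) : ℝ) : ℂ) * foxH 1 1 (case1Params α) z =
      ((∫ t in Set.Ioi 0,
        Real.exp (-t) * Real.exp (-(z * √t) ^ (2 * α .S / α .M)) : ℝ) : ℂ) := by
  have h : ∃ γ : ℝ, (case1Params α).Separates 1 1 γ := ⟨1, case1Params_separates_one hα⟩
  rw [foxH, dif_pos h, mellinInv_case1Params hα h.choose_spec hz]

theorem foxHConverges_case1Params {α : Tier → ℝ} (hα : ∀ k, 0 < α k) {z : ℝ} (hz : 0 < z) :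
    FoxHConverges 1 1 (case1Params α) z := by
  have hB : 0 < α .M / (2 * α .S) := div_pos (hα _) (mul_pos two_pos (hα _))
  refine ⟨⟨1, case1Params_separates_one hα⟩, fun γ hγ => ⟨?_, ?_⟩⟩
  · obtain ⟨h0, h2⟩ := (case1Params_separates hα).1 hγ
    rw [case1Params_kernel]
    exact verticalIntegrable_Gamma_mul_Gamma hB h0 h2
  · refine mul_left_cancel₀ (Complex.ofReal_ne_zero.2 hB.ne') ?_
    rw [mellinInv_case1Params hα hγ hz, mul_foxH_case1Params hα hz]

/-! ### Nearest points of a Poisson process -/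

theorem nearestDist_nonneg {Ω : Type*} (Φ : Ω → Set Plane) (ω : Ω) : 0 ≤ nearestDist Φ ω :=
  Metric.infDist_nonneg

theorem measurable_pointCount_pointProcessSigma {Ω : Type*} (Φ : Ω → Set Plane) {B : Set Plane}
    (hB : MeasurableSet B) (hb : Bornology.IsBounded B) :
    Measurable[pointProcessSigma Φ] (pointCount Φ B) :=
  Measurable.mono (comap_measurable _)
    (le_iSup_of_le B (le_iSup_of_le hB (le_iSup_of_le hb le_rfl))) le_rfl

namespace IsHomogeneousPPP

variable {Ω : Type*} [MeasurableSpace Ω] {μ : Measure Ω} {lam : ℝ} {Φ : Ω → Set Plane}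

theorem setOf_inter_eq_empty (h : IsHomogeneousPPP μ lam Φ) {B : Set Plane}
    (hb : Bornology.IsBounded B) : {ω | Φ ω ∩ B = ∅} = pointCount Φ B ⁻¹' {0} := by
  ext ω
  simp [pointCount, Set.ncard_eq_zero (h.locallyFinite ω B hb)]

/-- The void probabilities of a Poisson process. -/
theorem measure_inter_eq_empty (h : IsHomogeneousPPP μ lam Φ) (hlam : 0 ≤ lam) {B : Set Plane}
    (hB : MeasurableSet B) (hb : Bornology.IsBounded B) :
    μ {ω | Φ ω ∩ B = ∅} = ENNReal.ofReal (Real.exp (-(lam * volume.real B))) := by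
  rw [h.setOf_inter_eq_empty hb, ← Measure.map_apply (h.measurable_count B hB hb)
    (measurableSet_singleton 0), h.poisson_count B hB hb, poissonMeasure_singleton]
  simp [Real.coe_toNNReal _ (mul_nonneg hlam measureReal_nonneg)]

theorem measure_inter_closedBall_eq_empty (h : IsHomogeneousPPP μ lam Φ) (hlam : 0 ≤ lam) {r : ℝ}
    (hr : 0 ≤ r) :
    μ {ω | Φ ω ∩ Metric.closedBall 0 r = ∅} =
      ENNReal.ofReal (Real.exp (-(Real.pi * lam * r ^ 2))) := by
  have hv : volume.real (Metric.closedBall (0 : Plane) r) = Real.pi * r ^ 2 := by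
    rw [measureReal_def, EuclideanSpace.volume_closedBall_fin_two]
    simp [ENNReal.toReal_ofReal hr, ENNReal.toReal_ofReal Real.pi_pos.le, mul_comm]
  rw [h.measure_inter_eq_empty hlam measurableSet_closedBall Metric.isBounded_closedBall, hv]
  ring_nf

theorem ae_nonempty (h : IsHomogeneousPPP μ lam Φ) (hlam : 0 < lam) :
    ∀ᵐ ω ∂μ, (Φ ω).Nonempty := by
  have hlim : Filter.Tendsto (fun r : ℝ => ENNReal.ofReal (Real.exp (-(Real.pi * lam * r ^ 2))))
      Filter.atTop (nhds 0) := by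
    rw [← ENNReal.ofReal_zero]
    refine (ENNReal.continuous_ofReal.tendsto 0).comp (Real.tendsto_exp_neg_atTop_nhds_zero.comp ?_)
    exact (Filter.tendsto_pow_atTop two_ne_zero).const_mul_atTop (mul_pos Real.pi_pos hlam)
  rw [ae_iff]
  refine le_antisymm (ge_of_tendsto hlim ?_) bot_le
  filter_upwards [Filter.eventually_ge_atTop 0] with r hr
  rw [← h.measure_inter_closedBall_eq_empty hlam.le hr]
  refine measure_mono fun ω hω => ?_
  simp only [Set.mem_ofPred_eq, Set.not_nonempty_iff_eq_empty] at hω ⊢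
  simp [hω]

theorem exists_norm_eq_nearestDist (h : IsHomogeneousPPP μ lam Φ) {ω : Ω}
    (hne : (Φ ω).Nonempty) : ∃ x ∈ Φ ω, ‖x‖ = nearestDist Φ ω := by
  obtain ⟨z, hz⟩ := hne
  have hz' : z ∈ Φ ω ∩ Metric.closedBall 0 (dist z 0) := ⟨hz, by simp⟩
  obtain ⟨x, hx, hxd⟩ : ∃ x ∈ Φ ω ∩ Metric.closedBall 0 (dist z 0),
      Metric.infDist 0 (Φ ω ∩ Metric.closedBall 0 (dist z 0)) = dist 0 x :=
    (h.locallyFinite ω _ Metric.isBounded_closedBall).isCompact.exists_infDist_eq_dist ⟨z, hz'⟩ 0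
  refine ⟨x, hx.1, ?_⟩
  rw [← dist_zero_left x, ← hxd, nearestDist, Metric.infDist_inter_closedBall_of_mem hz]

theorem nearestDist_le_iff (h : IsHomogeneousPPP μ lam Φ) {ω : Ω} (hne : (Φ ω).Nonempty) {r : ℝ} :
    nearestDist Φ ω ≤ r ↔ (Φ ω ∩ Metric.closedBall 0 r).Nonempty := by
  constructor
  · intro hr
    obtain ⟨x, hx, hxn⟩ := h.exists_norm_eq_nearestDist hne
    exact ⟨x, hx, by simpa [hxn] using hr⟩
  · rintro ⟨x, hx, hxr⟩
    refine (Metric.infDist_le_dist_of_mem hx).trans ?_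
    rwa [dist_comm]

theorem pointProcessSigma_le (h : IsHomogeneousPPP μ lam Φ) :
    pointProcessSigma Φ ≤ ‹MeasurableSpace Ω› :=
  iSup_le fun B => iSup_le fun hB => iSup_le fun hb => (h.measurable_count B hB hb).comap_le

/-- The distance to the nearest point is measurable with respect to the counts of the process alone,
so that independence of two processes passes to their nearest distances. When the process is
empty, `nearestDist` is `0`. -/
theorem measurable_nearestDist (h : IsHomogeneousPPP μ lam Φ) :
    Measurable[pointProcessSigma Φ] (nearestDist Φ) := by
  have hS (r : ℝ) :
      MeasurableSet[pointProcessSigma Φ] {ω | Φ ω ∩ Metric.closedBall 0 r = ∅} := by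
    rw [h.setOf_inter_eq_empty Metric.isBounded_closedBall]
    exact measurable_pointCount_pointProcessSigma Φ measurableSet_closedBall
      Metric.isBounded_closedBall (measurableSet_singleton 0)
  have hE : MeasurableSet[pointProcessSigma Φ] {ω | Φ ω = ∅} := by
    have : {ω | Φ ω = ∅} = ⋂ n : ℕ, {ω | Φ ω ∩ Metric.closedBall 0 (n : ℝ) = ∅} := by
      ext ω
      simp only [Set.mem_ofPred_eq, Set.mem_iInter]
      refine ⟨fun h0 n => by simp [h0], fun h0 => Set.eq_empty_of_forall_notMem fun x hx => ?_⟩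
      obtain ⟨n, hn⟩ := exists_nat_ge ‖x‖
      exact (Set.eq_empty_iff_forall_notMem.1 (h0 n)) x ⟨hx, by simpa using hn⟩
    rw [this]
    exact MeasurableSet.iInter fun n => hS n
  refine measurable_of_Iic fun r => ?_
  rcases lt_or_ge r 0 with hr | hr
  · convert MeasurableSet.empty
    ext ω
    simpa using hr.trans_le (nearestDist_nonneg Φ ω)
  · convert hE.union (hS r).compl
    ext ω
    rcases (Φ ω).eq_empty_or_nonempty with h0 | h0
    · simp [nearestDist, h0, hr]
    · simp [h.nearestDist_le_iff h0, h0.ne_empty, Set.nonempty_iff_ne_empty]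

/-- `π λ X²` is a standard exponential variable, `X` being the distance to the nearest point: the
event `X > r` is, up to a null set, the void event of the closed disc of radius `r`. -/
theorem map_nearestDist_sq [IsProbabilityMeasure μ] (h : IsHomogeneousPPP μ lam Φ)
    (hlam : 0 < lam) :
    μ.map (fun ω => Real.pi * lam * nearestDist Φ ω ^ 2) = expMeasure 1 := by
  have hX : Measurable (nearestDist Φ) :=
    h.measurable_nearestDist.mono h.pointProcessSigma_le le_rfl
  have hT : Measurable fun ω => Real.pi * lam * nearestDist Φ ω ^ 2 := by fun_prop
  have := isProbabilityMeasure_expMeasure one_pos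
  have := Measure.isProbabilityMeasure_map (μ := μ) hT.aemeasurable
  have hpl : 0 < Real.pi * lam := mul_pos Real.pi_pos hlam
  refine Measure.eq_of_cdf _ _ (StieltjesFunction.ext fun x => ?_)
  rw [cdf_expMeasure_eq one_pos, cdf_eq_real, map_measureReal_apply hT measurableSet_Iic]
  split_ifs with hx
  · set r := √(x / (Real.pi * lam)) with hr
    have hr2 : Real.pi * lam * r ^ 2 = x := by
      rw [hr, Real.sq_sqrt (by positivity), mul_div_cancel₀ _ hpl.ne']
    have hset : (fun ω => Real.pi * lam * nearestDist Φ ω ^ 2) ⁻¹' Set.Iic x =ᵐ[μ]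
        ({ω | Φ ω ∩ Metric.closedBall 0 r = ∅}ᶜ : Set Ω) := by
      refine Filter.eventuallyEq_set.2 ?_
      filter_upwards [h.ae_nonempty hlam] with ω hω
      change Real.pi * lam * nearestDist Φ ω ^ 2 ≤ x ↔ ¬ (Φ ω ∩ Metric.closedBall 0 r = ∅)
      rw [← hr2, mul_le_mul_iff_right₀ hpl, sq_le_sq₀ (nearestDist_nonneg Φ ω) (Real.sqrt_nonneg _),
        h.nearestDist_le_iff hω, Set.nonempty_iff_ne_empty]
    have hm : MeasurableSet {ω | Φ ω ∩ Metric.closedBall 0 r = ∅} := by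
      rw [h.setOf_inter_eq_empty Metric.isBounded_closedBall]
      exact h.measurable_count _ measurableSet_closedBall Metric.isBounded_closedBall
        (measurableSet_singleton 0)
    rw [measureReal_congr hset, probReal_compl_eq_one_sub hm, measureReal_def,
      h.measure_inter_closedBall_eq_empty hlam.le (Real.sqrt_nonneg _), hr2,
      ENNReal.toReal_ofReal (Real.exp_pos _).le, one_mul]
  · have : (fun ω => Real.pi * lam * nearestDist Φ ω ^ 2) ⁻¹' Set.Iic x = ∅ := by
      ext ω
      simp only [Set.mem_preimage, Set.mem_Iic, Set.mem_empty_iff_false, iff_false, not_le]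
      exact (not_le.1 hx).trans_le (by positivity)
    simp [this]

theorem ae_nearestDist_pos [IsProbabilityMeasure μ] (h : IsHomogeneousPPP μ lam Φ)
    (hlam : 0 < lam) : ∀ᵐ ω ∂μ, 0 < nearestDist Φ ω := by
  have := isProbabilityMeasure_expMeasure one_pos
  have hX : Measurable (nearestDist Φ) :=
    h.measurable_nearestDist.mono h.pointProcessSigma_le le_rfl
  have h0 : expMeasure 1 (Set.Iic 0) = 0 := by
    rw [← measureReal_eq_zero_iff, ← cdf_eq_real, cdf_expMeasure_eq one_pos]
    simp
  rw [← h.map_nearestDist_sq hlam, Measure.map_apply (by fun_prop) measurableSet_Iic] at h0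
  filter_upwards [measure_eq_zero_iff_ae_notMem.1 h0] with ω hω
  refine (nearestDist_nonneg Φ ω).lt_of_ne fun h1 => hω ?_
  simp [← h1]

end IsHomogeneousPPP

/-! ### Two independent exponential variables -/

theorem expMeasure_one_Ioi {r : ℝ} (hr : 0 ≤ r) :
    expMeasure 1 (Set.Ioi r) = ENNReal.ofReal (Real.exp (-r)) := by
  have := isProbabilityMeasure_expMeasure one_pos
  rw [← Set.compl_Iic, ← ofReal_measureReal, probReal_compl_eq_one_sub measurableSet_Iic,
    ← cdf_eq_real, cdf_expMeasure_eq one_pos, if_pos hr]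
  simp

theorem expMeasure_one_eq_withDensity :
    expMeasure 1 = (volume.restrict (Set.Ioi 0)).withDensity
      fun t => ENNReal.ofReal (Real.exp (-t)) := by
  have : gammaPDF 1 1 =ᵐ[volume] (Set.Ioi 0).indicator fun t => ENNReal.ofReal (Real.exp (-t)) := by
    filter_upwards [compl_mem_ae_iff.2 (measure_singleton (0 : ℝ))] with t ht
    change exponentialPDF 1 t = _
    rw [exponentialPDF_eq, one_mul, one_mul]
    rcases lt_or_gt_of_ne (show t ≠ 0 from ht) with h | h
    · simp [h.not_ge, h.le]
    · simp [h, h.le]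
  rw [expMeasure, gammaMeasure, withDensity_congr_ae this, withDensity_indicator measurableSet_Ioi]

theorem expMeasure_one_singleton (r : ℝ) : expMeasure 1 {r} = 0 := by
  rw [expMeasure_one_eq_withDensity]
  exact withDensity_absolutelyContinuous _ _ (measure_singleton r)

theorem expMeasure_prod_setOf_lt {g : ℝ → ℝ} (hg : Measurable g) (hg0 : ∀ t, 0 ≤ g t) :
    ((expMeasure 1).prod (expMeasure 1)).real {p | g p.2 < p.1} =
      ∫ t in Set.Ioi 0, Real.exp (-t) * Real.exp (-g t) := by
  have := isProbabilityMeasure_expMeasure one_pos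
  have hm : MeasurableSet {p : ℝ × ℝ | g p.2 < p.1} :=
    measurableSet_lt (hg.comp measurable_snd) measurable_fst
  have hfib (t : ℝ) : (fun x => (x, t)) ⁻¹' {p : ℝ × ℝ | g p.2 < p.1} = Set.Ioi (g t) := rfl
  rw [measureReal_def, Measure.prod_apply_symm hm, integral_eq_lintegral_of_nonneg_ae
    (Filter.Eventually.of_forall fun t => by positivity) (by fun_prop)]
  simp_rw [hfib, expMeasure_one_Ioi (hg0 _)]
  nth_rw 1 [expMeasure_one_eq_withDensity]
  rw [lintegral_withDensity_eq_lintegral_mul _ (by fun_prop) (by fun_prop)]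
  simp_rw [Pi.mul_apply, ← ENNReal.ofReal_mul (Real.exp_pos _).le]

/-- A tie between an exponential variable and a function of an independent one has probability
zero. -/
theorem expMeasure_prod_setOf_eq {g : ℝ → ℝ} (hg : Measurable g) :
    ((expMeasure 1).prod (expMeasure 1)) {p | p.1 = g p.2} = 0 := by
  have := isProbabilityMeasure_expMeasure one_pos
  have hm : MeasurableSet {p : ℝ × ℝ | p.1 = g p.2} :=
    measurableSet_eq_fun measurable_fst (hg.comp measurable_snd)
  have hfib (t : ℝ) : (fun x => (x, t)) ⁻¹' {p : ℝ × ℝ | p.1 = g p.2} = {g t} := rfl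
  rw [Measure.prod_apply_symm hm]
  simp_rw [hfib, expMeasure_one_singleton, lintegral_zero]

/-! ### Association through the nearest points -/

theorem linkPower_le_of_mem {W G α : Tier → ℝ} (hW : ∀ k, 0 < W k) (hG : ∀ k, 0 < G k)
    (hα : ∀ k, 0 < α k) {Ω : Type*} {Φ : Ω → Set Plane} {ω : Ω} (h0 : 0 < nearestDist Φ ω)
    (k : Tier) {x : Plane} (hx : x ∈ Φ ω) :
    linkPower W G α k x ≤ W k * G k * nearestDist Φ ω ^ (-α k) := by
  have hle : nearestDist Φ ω ≤ ‖x‖ := by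
    rw [← dist_zero_left x]
    exact Metric.infDist_le_dist_of_mem hx
  exact mul_le_mul_of_nonneg_left
    (Real.rpow_le_rpow_of_nonpos h0 hle (neg_nonpos.2 (hα k).le)) (mul_pos (hW k) (hG k)).le

/-- For any transmit powers the nearest point of a tier maximises the link power in that tier. So
some Mcell is the base station for both power profiles if and only if the nearest Mcell is at least
as strong as the nearest Scell under each of them. Positivity of the distances excludes a point at
the origin, where `0 ^ (-α) = 0`. -/
theorem exists_UEAssociates_iff {W V G α : Tier → ℝ} (hW : ∀ k, 0 < W k) (hV : ∀ k, 0 < V k)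
    (hG : ∀ k, 0 < G k) (hα : ∀ k, 0 < α k) {Ω : Type*} {Φ : Tier → Ω → Set Plane} {ω : Ω}
    (h0 : ∀ k, 0 < nearestDist (Φ k) ω)
    (hn : ∀ k, ∃ x ∈ Φ k ω, ‖x‖ = nearestDist (Φ k) ω) :
    (∃ x, UEAssociates W G α (fun k => Φ k ω) .M x ∧ UEAssociates V G α (fun k => Φ k ω) .M x) ↔
      (W .S * G .S) / (W .M * G .M) * nearestDist (Φ .S) ω ^ (-α .S) ≤
          nearestDist (Φ .M) ω ^ (-α .M) ∧
        (V .S * G .S) / (V .M * G .M) * nearestDist (Φ .S) ω ^ (-α .S) ≤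
          nearestDist (Φ .M) ω ^ (-α .M) := by
  have key {U : Tier → ℝ} (hU : ∀ k, 0 < U k) :
      (U .S * G .S) / (U .M * G .M) * nearestDist (Φ .S) ω ^ (-α .S) ≤
          nearestDist (Φ .M) ω ^ (-α .M) ↔
        U .S * G .S * nearestDist (Φ .S) ω ^ (-α .S) ≤
          U .M * G .M * nearestDist (Φ .M) ω ^ (-α .M) := by
    rw [div_mul_eq_mul_div, div_le_iff₀' (mul_pos (hU _) (hG _))]
  rw [key hW, key hV]
  constructor
  · obtain ⟨y, hy, hyn⟩ := hn .S
    have h {U : Tier → ℝ} (hU : ∀ k, 0 < U k) {x : Plane}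
        (hx : UEAssociates U G α (fun k => Φ k ω) .M x) :
        U .S * G .S * nearestDist (Φ .S) ω ^ (-α .S) ≤
          U .M * G .M * nearestDist (Φ .M) ω ^ (-α .M) := by
      rw [← hyn]
      exact (hx.2 .S y hy).trans (linkPower_le_of_mem hU hG hα (h0 .M) .M hx.1)
    rintro ⟨x, hx, hx'⟩
    exact ⟨h hW hx, h hV hx'⟩
  · obtain ⟨x, hx, hxn⟩ := hn .M
    have h {U : Tier → ℝ} (hU : ∀ k, 0 < U k)
        (hle : U .S * G .S * nearestDist (Φ .S) ω ^ (-α .S) ≤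
          U .M * G .M * nearestDist (Φ .M) ω ^ (-α .M)) :
        UEAssociates U G α (fun k => Φ k ω) .M x := by
      refine ⟨hx, fun k y hy => (linkPower_le_of_mem hU hG hα (h0 k) k hy).trans ?_⟩
      rw [linkPower, hxn]
      cases k
      · rfl
      · exact hle
    rintro ⟨h1, h2⟩
    exact ⟨x, h hW h1, h hV h2⟩

/-- The ratio of the two biased powers in terms of the variables `π λ_M x²` and `π λ_S y²`, whose
laws do not depend on the parameters; `z1` collects all of the constants. -/
theorem nearest_scaling {lam Q G α : Tier → ℝ} (hlam : ∀ k, 0 < lam k) (hQ : ∀ k, 0 < Q k)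
    (hG : ∀ k, 0 < G k) (hα : ∀ k, 0 < α k) {x y : ℝ} (hx : 0 < x) (hy : 0 < y) :
    Real.pi * lam .M * x ^ 2 =
      ((Q .S * G .S) / (Q .M * G .M) * y ^ (-α .S) / x ^ (-α .M)) ^ (2 / α .M) *
        (z1 lam Q G α * √(Real.pi * lam .S * y ^ 2)) ^ (2 * α .S / α .M) := by
  have ha := mul_pos Real.pi_pos (hlam .M)
  have hb := mul_pos Real.pi_pos (hlam .S)
  have hc := mul_pos (hQ .M) (hG .M)
  have hd := mul_pos (hQ .S) (hG .S)
  have hαM := hα .M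
  have hαS := hα .S
  unfold z1
  generalize Real.pi * lam .M = a at *
  generalize Real.pi * lam .S = b at *
  generalize Q .M * G .M = c at *
  generalize Q .S * G .S = d at *
  refine Real.log_injOn_pos (Set.mem_Ioi.2 (by positivity)) (Set.mem_Ioi.2 (by positivity)) ?_
  have hz : Real.log (√a ^ (α .M / α .S) * (c / d) ^ (1 / α .S) * (√b)⁻¹ * √(b * y ^ 2)) =
      α .M / α .S * (Real.log a / 2) + 1 / α .S * (Real.log c - Real.log d) -
        Real.log b / 2 + (Real.log b + 2 * Real.log y) / 2 := by
    rw [Real.log_mul (by positivity) (by positivity), Real.log_mul (by positivity) (by positivity),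
      Real.log_mul (by positivity) (by positivity), Real.log_rpow (by positivity),
      Real.log_rpow (by positivity), Real.log_div hc.ne' hd.ne', Real.log_inv,
      Real.log_sqrt ha.le, Real.log_sqrt hb.le, Real.log_sqrt (by positivity),
      Real.log_mul hb.ne' (by positivity), Real.log_pow]
    push_cast
    ring
  have hr : Real.log (d / c * y ^ (-α .S) / x ^ (-α .M)) =
      Real.log d - Real.log c - α .S * Real.log y + α .M * Real.log x := by
    rw [Real.log_div (by positivity) (by positivity), Real.log_mul (by positivity) (by positivity),
      Real.log_rpow hx, Real.log_rpow hy, Real.log_div hd.ne' hc.ne']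
    ring
  rw [Real.log_mul (by positivity) (by positivity), Real.log_mul (by positivity) (by positivity),
    Real.log_rpow (by positivity), Real.log_rpow (by positivity), hz, hr, Real.log_pow]
  push_cast
  field_simp
  ring

theorem z1_pos {lam Q G α : Tier → ℝ} (hlam : ∀ k, 0 < lam k) (hQ : ∀ k, 0 < Q k)
    (hG : ∀ k, 0 < G k) : 0 < z1 lam Q G α := by
  have ha := mul_pos Real.pi_pos (hlam .M)
  have hb := mul_pos Real.pi_pos (hlam .S)
  have hc := mul_pos (hQ .M) (hG .M)
  have hd := mul_pos (hQ .S) (hG .S)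
  unfold z1
  positivity

theorem le_threshold_iff {lam Q G α : Tier → ℝ} (hlam : ∀ k, 0 < lam k) (hQ : ∀ k, 0 < Q k)
    (hG : ∀ k, 0 < G k) (hα : ∀ k, 0 < α k) {x y : ℝ} (hx : 0 < x) (hy : 0 < y) :
    (Q .S * G .S) / (Q .M * G .M) * y ^ (-α .S) ≤ x ^ (-α .M) ↔
      Real.pi * lam .M * x ^ 2 ≤
        (z1 lam Q G α * √(Real.pi * lam .S * y ^ 2)) ^ (2 * α .S / α .M) := by
  have hz := z1_pos (α := α) hlam hQ hG
  have hb := mul_pos Real.pi_pos (hlam .S)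
  have hc := mul_pos (hQ .M) (hG .M)
  have hd := mul_pos (hQ .S) (hG .S)
  have he : 0 < 2 / α .M := div_pos two_pos (hα .M)
  rw [nearest_scaling hlam hQ hG hα hx hy, mul_le_iff_le_one_left (by positivity)]
  nth_rw 1 [← Real.one_rpow (2 / α .M)]
  rw [Real.rpow_le_rpow_iff (by positivity) zero_le_one he, div_le_one (by positivity)]

theorem lt_threshold_iff {lam Q G α : Tier → ℝ} (hlam : ∀ k, 0 < lam k) (hQ : ∀ k, 0 < Q k)
    (hG : ∀ k, 0 < G k) (hα : ∀ k, 0 < α k) {x y : ℝ} (hx : 0 < x) (hy : 0 < y) :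
    (Q .S * G .S) / (Q .M * G .M) * y ^ (-α .S) < x ^ (-α .M) ↔
      Real.pi * lam .M * x ^ 2 <
        (z1 lam Q G α * √(Real.pi * lam .S * y ^ 2)) ^ (2 * α .S / α .M) := by
  have hz := z1_pos (α := α) hlam hQ hG
  have hb := mul_pos Real.pi_pos (hlam .S)
  have hc := mul_pos (hQ .M) (hG .M)
  have hd := mul_pos (hQ .S) (hG .S)
  have he : 0 < 2 / α .M := div_pos two_pos (hα .M)
  rw [nearest_scaling hlam hQ hG hα hx hy, mul_lt_iff_lt_one_left (by positivity)]
  nth_rw 1 [← Real.one_rpow (2 / α .M)]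
  rw [Real.rpow_lt_rpow_iff (by positivity) zero_le_one he, div_lt_one (by positivity)]

/-! ### The probability of Case 1 -/

theorem lemma1 {Ω : Type*} [MeasurableSpace Ω] (μ : Measure Ω) [IsProbabilityMeasure μ]
    (lam P Q G α : Tier → ℝ)
    (hlam : ∀ k, 0 < lam k) (hP : ∀ k, 0 < P k) (hQ : ∀ k, 0 < Q k) (hG : ∀ k, 0 < G k)
    (hα : ∀ k, 0 < α k)
    (hPQ : (P .S * G .S) / (P .M * G .M) < (Q .S * G .S) / (Q .M * G .M))
    (Φ : Tier → Ω → Set Plane)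
    (hΦ : ∀ k, IsHomogeneousPPP μ (lam k) (Φ k))
    (hindep : Indep (pointProcessSigma (Φ .M)) (pointProcessSigma (Φ .S)) μ) :
    FoxHConverges 1 1 (case1Params α) (z1 lam Q G α) ∧
      NullMeasurableSet (case1 P Q G α Φ) μ ∧
      case1 P Q G α Φ =ᵐ[μ] case1Dist P Q G α Φ ∧
      ((μ.real (case1 P Q G α Φ) : ℝ) : ℂ) =
        1 - ((α .M / (2 * α .S) : ℝ) : ℂ) *
          foxH 1 1 (case1Params α) (z1 lam Q G α) := by
  have hz := z1_pos (α := α) hlam hQ hG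
  have hXσ (k : Tier) := (hΦ k).measurable_nearestDist
  have hX (k : Tier) : Measurable (nearestDist (Φ k)) :=
    (hXσ k).mono (hΦ k).pointProcessSigma_le le_rfl
  set T : Tier → Ω → ℝ := fun k ω => Real.pi * lam k * nearestDist (Φ k) ω ^ 2
  have hTm (k : Tier) : Measurable (T k) := by fun_prop
  set g : ℝ → ℝ := fun t => (z1 lam Q G α * √t) ^ (2 * α .S / α .M)
  have hgm : Measurable g := by fun_prop
  have hg0 (t : ℝ) : 0 ≤ g t := by positivity
  have hjoint : μ.map (fun ω => (T .M ω, T .S ω)) = (expMeasure 1).prod (expMeasure 1) := by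
    have hind : IndepFun (T .M) (T .S) μ := by
      have h : IndepFun (nearestDist (Φ .M)) (nearestDist (Φ .S)) μ :=
        indep_of_indep_of_le_right (indep_of_indep_of_le_left hindep (hXσ .M).comap_le)
          (hXσ .S).comap_le
      exact h.comp (φ := fun x => Real.pi * lam .M * x ^ 2)
        (ψ := fun x => Real.pi * lam .S * x ^ 2) (by fun_prop) (by fun_prop)
    rw [(indepFun_iff_map_prod_eq_prod_map_map (hTm .M).aemeasurable (hTm .S).aemeasurable).1 hind,
      (hΦ .M).map_nearestDist_sq (hlam .M), (hΦ .S).map_nearestDist_sq (hlam .S)]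
  have hTT : Measurable fun ω => (T .M ω, T .S ω) := (hTm .M).prodMk (hTm .S)
  have htie : ∀ᵐ ω ∂μ, T .M ω ≠ g (T .S ω) := by
    have h := expMeasure_prod_setOf_eq hgm
    have hm : MeasurableSet {p : ℝ × ℝ | p.1 = g p.2} :=
      measurableSet_eq_fun measurable_fst (hgm.comp measurable_snd)
    rw [← hjoint, Measure.map_apply hTT hm] at h
    exact measure_eq_zero_iff_ae_notMem.1 h
  have hpos : ∀ᵐ ω ∂μ, ∀ k, 0 < nearestDist (Φ k) ω := by
    filter_upwards [(hΦ .M).ae_nearestDist_pos (hlam .M), (hΦ .S).ae_nearestDist_pos (hlam .S)]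
      with ω hM hS k
    cases k <;> assumption
  have hne : ∀ᵐ ω ∂μ, ∀ k, ∃ x ∈ Φ k ω, ‖x‖ = nearestDist (Φ k) ω := by
    filter_upwards [(hΦ .M).ae_nonempty (hlam .M), (hΦ .S).ae_nonempty (hlam .S)] with ω hM hS k
    cases k
    exacts [(hΦ .M).exists_norm_eq_nearestDist hM, (hΦ .S).exists_norm_eq_nearestDist hS]
  -- The downlink condition is implied by the uplink one, since its constant is smaller.
  have hdrop {ω : Ω} (h0 : ∀ k, 0 < nearestDist (Φ k) ω) :
      (P .S * G .S) / (P .M * G .M) * nearestDist (Φ .S) ω ^ (-α .S) <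
        (Q .S * G .S) / (Q .M * G .M) * nearestDist (Φ .S) ω ^ (-α .S) :=
    mul_lt_mul_of_pos_right hPQ (Real.rpow_pos_of_pos (h0 .S) _)
  have hcase : case1 P Q G α Φ =ᵐ[μ] {ω | T .M ω ≤ g (T .S ω)} := by
    refine Filter.eventuallyEq_set.2 ?_
    filter_upwards [hpos, hne] with ω h0 hn
    refine (exists_UEAssociates_iff hQ hP hG hα h0 hn).trans ?_
    refine Iff.trans ?_ (le_threshold_iff hlam hQ hG hα (h0 .M) (h0 .S))
    exact ⟨And.left, fun h => ⟨h, (hdrop h0).le.trans h⟩⟩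
  have hdist : case1Dist P Q G α Φ =ᵐ[μ] {ω | T .M ω ≤ g (T .S ω)} := by
    refine Filter.eventuallyEq_set.2 ?_
    filter_upwards [hpos, htie] with ω h0 ht
    refine Iff.trans ⟨And.right, fun h => ⟨(hdrop h0).trans h, h⟩⟩ ?_
    refine (lt_threshold_iff hlam hQ hG hα (h0 .M) (h0 .S)).trans ?_
    exact ⟨le_of_lt, fun h => lt_of_le_of_ne h ht⟩
  have hmeas : MeasurableSet {ω | T .M ω ≤ g (T .S ω)} :=
    measurableSet_le (hTm .M) (hgm.comp (hTm .S))
  refine ⟨foxHConverges_case1Params hα hz, hmeas.nullMeasurableSet.congr hcase.symm,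
    hcase.trans hdist.symm, ?_⟩
  have hlt : {ω | T .M ω ≤ g (T .S ω)} =
      ((fun ω => (T .M ω, T .S ω)) ⁻¹' {p : ℝ × ℝ | g p.2 < p.1})ᶜ := by
    ext ω
    simp
  have hmlt : MeasurableSet {p : ℝ × ℝ | g p.2 < p.1} :=
    measurableSet_lt (hgm.comp measurable_snd) measurable_fst
  rw [measureReal_congr hcase, hlt, probReal_compl_eq_one_sub (hTT hmlt),
    ← map_measureReal_apply hTT hmlt, hjoint, expMeasure_prod_setOf_lt hgm hg0,
    mul_foxH_case1Params hα hz]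
  push_cast
  rfl
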